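/- Let $\omega=\{0,1,2,\dots\}$. A family $\mathcal A$ of infinite subsets of $\omega$ is \emph{almost disjoint} if for all $x,y\in\mathcal A$ either $x=y$ or $x\cap y$ is finite; it is a \emph{mad family} (maximal almost disjoint family) if it is almost disjoint and no strictly larger almost disjoint family of infinite subsets of $\omega$ contains it. Identify $\mathcal P(\omega)$ with the Cantor space $\{0,1\}^{\omega}$ via characteristic functions. A subset of a Polish space $X$ is (boldface) $\mathbf{\Sigma}^1_2$ if it is the projection to $X$ of a coanalytic subset of $X\times\omega^{\omega}$. $\mathrm{MA}(\aleph_1)$ is the statement: for every nonempty partial order $\mathbb P$ (reflexive and transitive; antisymmetry is not required) with the countable chain condition and every family $\mathcal D$ of at most $\aleph_1$ dense subsets of $\mathbb P$ there is a filter $G\subseteq\mathbb P$ with $G\cap D\neq\emptyset$ for all $D\in\mathcal D$. Corollary. If $\mathrm{MA}(\aleph_1)$ holds, then there is no infinite $\mathbf{\Sigma}^1_2$ mad family. -/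

import Mathlib

/-- A family of subsets of `ℕ` is almost disjoint if its members are infinite sets, any two
distinct ones having finite intersection. -/
structure IsAlmostDisjoint (𝒜 : Set (Set ℕ)) : Prop where
  infinite_of_mem : ∀ x ∈ 𝒜, x.Infinite
  eq_or_finite_inter : ∀ x ∈ 𝒜, ∀ y ∈ 𝒜, x = y ∨ (x ∩ y).Finite

/-- A mad family: an almost disjoint family that is contained in no strictly larger one. -/
def IsMadFamily (𝒜 : Set (Set ℕ)) : Prop :=
  Maximal IsAlmostDisjoint 𝒜

/-- The countable chain condition: every set of pairwise incompatible conditions is countable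
(`p` and `q` are compatible if some `r` satisfies `r ≤ p` and `r ≤ q`). -/
def IsCCC (P : Type*) [Preorder P] : Prop :=
  ∀ A : Set P, IsStrongAntichain (· ≥ ·) A → A.Countable

/-- A set of conditions is dense if every condition has an extension (a smaller condition)
in it. -/
def IsForcingDense {P : Type*} [Preorder P] (D : Set P) : Prop :=
  ∀ p : P, ∃ d ∈ D, d ≤ p

/-- `MA(κ)`: for every nonempty ccc partial (pre)order `P` and every family of at most `κ` dense
subsets of `P` there is a filter in `P` that meets all of them. -/
def MartinsAxiomAt (κ : Cardinal.{0}) : Prop :=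
  ∀ (P : Type) [Preorder P] [Nonempty P], IsCCC P →
    ∀ 𝒟 : Set (Set P), Cardinal.mk 𝒟 ≤ κ → (∀ D ∈ 𝒟, IsForcingDense D) →
      ∃ G : Order.PFilter P, ∀ D ∈ 𝒟, ∃ p ∈ D, p ∈ G

/-- Boldface `Σ¹₂` subsets of a Polish space `X`: the projections to `X` of the coanalytic
subsets of `X × ℕ^ℕ`. -/
def IsBoldSigmaOneTwo {X : Type*} [TopologicalSpace X] (A : Set X) : Prop :=
  ∃ B : Set (X × (ℕ → ℕ)), MeasureTheory.AnalyticSet Bᶜ ∧ A = Prod.fst '' B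

/-- A family of subsets of `ℕ`, viewed as a subset of the Cantor space `{0,1}^ℕ` by identifying
a subset of `ℕ` with its characteristic function. -/
def toCantor (𝒜 : Set (Set ℕ)) : Set (ℕ → Bool) :=
  {f | {n | f n = true} ∈ 𝒜}

open Set Filter Topology MeasureTheory

/-! Suppose `𝒜` is such a family. A coanalytic set is a union of `ℵ₁` analytic sets, hence `𝒜` is a
union of analytic subfamilies indexed by `o < ω₁`. Work with the sets positive for the ideal
generated by `𝒜` and the finite sets. By `IsMadFamily.exists_isPositive_finite_inter`, a positive
set can be shrunk, staying positive, to one almost disjoint from every member of a given analytic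
subfamily. Maximality makes positivity σ-closed modulo finite sets
(`IsMadFamily.exists_isPositive_finite_diff`), so all these requirements are met along an almost
decreasing tower of length `ω₁` (`IsMadFamily.exists_tower`). `MA(ℵ₁)` gives the tower an infinite
pseudo-intersection, which is almost disjoint from all of `𝒜`, against maximality. -/

/-- A set is positive for `𝒜` if no finite subfamily of `𝒜` covers it up to a finite set. -/
def IsPositive (𝒜 : Set (Set ℕ)) (x : Set ℕ) : Prop :=
  ∀ F ⊆ 𝒜, F.Finite → (x \ ⋃₀ F).Infinite

/-! ### Positive sets of a mad family and their σ-closure. -/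

section Positive

variable {𝒜 : Set (Set ℕ)} {x y : Set ℕ}

theorem finite_diff_trans {x y z : Set ℕ} (h₁ : (x \ y).Finite) (h₂ : (y \ z).Finite) :
    (x \ z).Finite :=
  (h₁.union h₂).subset fun n hn => by
    by_cases h : n ∈ y
    · exact Or.inr ⟨h, hn.2⟩
    · exact Or.inl ⟨hn.1, h⟩

theorem finite_inter_of_finite_diff {x y b : Set ℕ} (h₁ : (x \ y).Finite)
    (h₂ : (y ∩ b).Finite) : (x ∩ b).Finite :=
  (h₁.union h₂).subset fun n hn => by
    by_cases h : n ∈ y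
    · exact Or.inr ⟨h, hn.2⟩
    · exact Or.inl ⟨hn.1, h⟩

theorem IsPositive.of_finite_diff (hx : IsPositive 𝒜 x) (h : (x \ y).Finite) :
    IsPositive 𝒜 y := fun F hF hfin hy =>
  hx F hF hfin (finite_diff_trans h hy)

theorem IsPositive.infinite (hx : IsPositive 𝒜 x) : x.Infinite := by
  simpa using hx ∅ (empty_subset _) finite_empty

theorem IsPositive.diff_sUnion (hx : IsPositive 𝒜 x) {F : Set (Set ℕ)} (hF : F ⊆ 𝒜)
    (hfin : F.Finite) : IsPositive 𝒜 (x \ ⋃₀ F) := fun G hG hGfin => by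
  rw [sdiff_sdiff, ← sUnion_union]
  exact hx _ (union_subset hF hG) (hfin.union hGfin)

/-- Sets that are not positive form an ideal. -/
theorem IsPositive.inter_of_diff (hx : IsPositive 𝒜 x) (h : ¬ IsPositive 𝒜 (x \ y)) :
    IsPositive 𝒜 (x ∩ y) := by
  simp only [IsPositive, not_forall, not_infinite] at h
  obtain ⟨F, hF, hfin, h⟩ := h
  refine (hx.diff_sUnion hF hfin).of_finite_diff (h.subset fun n hn => ?_)
  exact ⟨⟨hn.1.1, fun hy => hn.2 ⟨hn.1.1, hy⟩⟩, hn.1.2⟩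

theorem IsAlmostDisjoint.finite_inter_sUnion (h𝒜 : IsAlmostDisjoint 𝒜) {a : Set ℕ} (ha : a ∈ 𝒜)
    {F : Set (Set ℕ)} (hF : F ⊆ 𝒜) (hfin : F.Finite) (haF : a ∉ F) : (a ∩ ⋃₀ F).Finite := by
  rw [sUnion_eq_biUnion, inter_iUnion₂]
  refine hfin.biUnion fun b hb => (h𝒜.eq_or_finite_inter a ha b (hF hb)).resolve_left ?_
  rintro rfl
  exact haF hb

/-- A set with infinite trace on infinitely many members of an almost disjoint family is
positive. -/
theorem IsAlmostDisjoint.isPositive (h𝒜 : IsAlmostDisjoint 𝒜) {S : Set (Set ℕ)} (hS : S ⊆ 𝒜)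
    (hinf : S.Infinite) (h : ∀ a ∈ S, (a ∩ x).Infinite) : IsPositive 𝒜 x := by
  intro F hF hfin hx
  obtain ⟨a, haS, haF⟩ := hinf.exists_notMem_finite hfin
  refine h a haS (((h𝒜.finite_inter_sUnion (hS haS) hF hfin haF).union hx).subset fun n hn => ?_)
  by_cases hn' : n ∈ ⋃₀ F
  · exact Or.inl ⟨hn.1, hn'⟩
  · exact Or.inr ⟨hn.2, hn'⟩

theorem IsMadFamily.exists_infinite_inter (h𝒜 : IsMadFamily 𝒜) (hx : x.Infinite) :
    ∃ a ∈ 𝒜, (a ∩ x).Infinite := by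
  by_contra! hcon
  have hfin : ∀ a ∈ 𝒜, (a ∩ x).Finite := hcon
  have had : IsAlmostDisjoint (insert x 𝒜) := by
    refine ⟨?_, ?_⟩
    · rintro a (rfl | ha)
      · exact hx
      · exact h𝒜.prop.infinite_of_mem a ha
    · rintro a (rfl | ha) b (rfl | hb)
      · exact Or.inl rfl
      · exact Or.inr (inter_comm a b ▸ hfin b hb)
      · exact Or.inr (hfin a ha)
      · exact h𝒜.prop.eq_or_finite_inter a ha b hb
  have hmem : x ∈ 𝒜 := h𝒜.le_of_ge had (subset_insert x 𝒜) (mem_insert x 𝒜)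
  exact hx (by simpa using hfin x hmem)

theorem exists_infinite_finite_diff {C : ℕ → Set ℕ} (hC : Antitone C)
    (hinf : ∀ n, (C n).Infinite) : ∃ y ⊆ C 0, y.Infinite ∧ ∀ n, (y \ C n).Finite := by
  choose k hk hkn using fun n => (hinf n).exists_gt n
  refine ⟨range k, ?_, ?_, fun n => ?_⟩
  · rintro _ ⟨n, rfl⟩
    exact hC (Nat.zero_le n) (hk n)
  · refine infinite_of_not_bddAbove fun ⟨m, hm⟩ => ?_
    exact (hkn m).not_ge (hm (mem_range_self m))
  · refine ((finite_Iio n).image k).subset ?_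
    rintro _ ⟨⟨m, rfl⟩, hm⟩
    exact ⟨m, lt_of_not_ge fun h => hm (hC h (hk m)), rfl⟩

/-- The positive sets of a mad family are closed under pseudo-intersections of decreasing
sequences. -/
theorem IsMadFamily.exists_isPositive_finite_diff (h𝒜 : IsMadFamily 𝒜) {C : ℕ → Set ℕ}
    (hC : Antitone C) (hpos : ∀ n, IsPositive 𝒜 (C n)) :
    ∃ y, IsPositive 𝒜 y ∧ ∀ n, (y \ C n).Finite := by
  -- If there were finitely many such members, remove them: by maximality some member meets a
  -- pseudo-intersection of what is left in an infinite set, and it would be one of those removed.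
  have hS : {a ∈ 𝒜 | ∀ n, (a ∩ C n).Infinite}.Infinite := by
    intro hfin
    obtain ⟨y, hy0, hyinf, hy⟩ := exists_infinite_finite_diff
      (C := fun n => C n \ ⋃₀ {a ∈ 𝒜 | ∀ n, (a ∩ C n).Infinite})
      (fun m n h => sdiff_subset_sdiff_left (hC h))
      (fun n => hpos n _ (sep_subset _ _) hfin)
    obtain ⟨a, ha, hay⟩ := h𝒜.exists_infinite_inter hyinf
    have haS : a ∈ {a ∈ 𝒜 | ∀ n, (a ∩ C n).Infinite} := by
      refine ⟨ha, fun n hn => hay ?_⟩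
      rw [inter_comm] at hn ⊢
      exact finite_inter_of_finite_diff
        ((hy n).subset (sdiff_subset_sdiff_right sdiff_subset)) hn
    obtain ⟨n, hna, hny⟩ := hay.nonempty
    exact (hy0 hny).2 ⟨a, haS, hna⟩
  have e := hS.natEmbedding
  -- Unpairing returns to each `e i` infinitely often: stage `Nat.pair i m` picks an element of `e
  -- i` above `m`.
  have hk : ∀ m : ℕ, ∃ k ∈ (e m.unpair.1 : Set ℕ) ∩ C m, m < k := fun m =>
    ((e m.unpair.1).2.2 m).exists_gt m
  choose k hk hkm using hk
  refine ⟨range k, h𝒜.prop.isPositive (S := range fun i => (e i : Set ℕ)) ?_ ?_ ?_, fun n => ?_⟩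
  · rintro _ ⟨i, rfl⟩
    exact (e i).2.1
  · exact infinite_range_of_injective (Subtype.val_injective.comp e.injective)
  · rintro _ ⟨i, rfl⟩
    refine infinite_of_not_bddAbove fun ⟨m, hm⟩ => ?_
    have h1 : k (Nat.pair i m) ≤ m := hm ⟨by simpa using (hk (Nat.pair i m)).1, mem_range_self _⟩
    exact absurd (hkm (Nat.pair i m)) (not_lt.2 (h1.trans (Nat.right_le_pair i m)))
  · refine ((finite_Iio n).image k).subset ?_
    rintro _ ⟨⟨m, rfl⟩, hm⟩
    exact ⟨m, lt_of_not_ge fun h => hm (hC h (hk m).2), rfl⟩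

/-- Countably many dense, almost-hereditary requirements on positive sets can be met at once. -/
theorem IsMadFamily.exists_isPositive_forall (h𝒜 : IsMadFamily 𝒜) {D : ℕ → Set ℕ → Prop}
    (hdense : ∀ n x, IsPositive 𝒜 x → ∃ y ⊆ x, IsPositive 𝒜 y ∧ D n y)
    (hhered : ∀ n y z, D n y → (z \ y).Finite → D n z) (hx : IsPositive 𝒜 x) :
    ∃ y, IsPositive 𝒜 y ∧ (y \ x).Finite ∧ ∀ n, D n y := by
  choose! next hsub hpos hD using hdense
  let C : ℕ → Set ℕ := fun n => Nat.rec x next n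
  have hCpos : ∀ n, IsPositive 𝒜 (C n) := fun n => by
    induction n with
    | zero => exact hx
    | succ n ih => exact hpos n _ ih
  obtain ⟨y, hy, hyC⟩ := h𝒜.exists_isPositive_finite_diff
    (antitone_nat_of_succ_le fun n => hsub n _ (hCpos n)) hCpos
  exact ⟨y, hy, hyC 0, fun n => hhered n _ _ (hD n _ (hCpos n)) (hyC (n + 1))⟩

/-- This carries the tower through countable limit stages. -/
theorem IsMadFamily.exists_isPositive_of_countable (h𝒜 : IsMadFamily 𝒜) {𝒞 : Set (Set ℕ)}
    (hcount : 𝒞.Countable) (hpos : ∀ F ⊆ 𝒞, F.Finite → IsPositive 𝒜 (⋂₀ F)) :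
    ∃ y, IsPositive 𝒜 y ∧ ∀ c ∈ 𝒞, (y \ c).Finite := by
  rcases 𝒞.eq_empty_or_nonempty with rfl | hne
  · exact ⟨_, hpos ∅ Subset.rfl finite_empty, by simp⟩
  obtain ⟨c, rfl⟩ := hcount.exists_eq_range hne
  obtain ⟨y, hy, hyC⟩ := h𝒜.exists_isPositive_finite_diff (C := fun n => ⋂₀ (c '' Iic n))
    (fun m n h => sInter_subset_sInter (image_mono (Iic_subset_Iic.2 h)))
    (fun n => hpos _ (image_subset_range _ _) ((finite_Iic n).image c))
  refine ⟨y, hy, ?_⟩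
  rintro _ ⟨n, rfl⟩
  exact (hyC n).subset (sdiff_subset_sdiff_right (sInter_subset_of_mem ⟨n, self_mem_Iic, rfl⟩))

theorem IsMadFamily.isPositive_univ (h𝒜 : IsMadFamily 𝒜) (hinf : 𝒜.Infinite) :
    IsPositive 𝒜 univ :=
  h𝒜.prop.isPositive Subset.rfl hinf fun a ha => by simpa using h𝒜.prop.infinite_of_mem a ha

end Positive

/-! ### Mathias–Prikry forcing and pseudo-intersections. -/

section MartinsAxiom

/-- The Mathias–Prikry conditions of a family `𝒞`: finite sets together with finitely many
members of `𝒞`, into which extensions promise to grow. -/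
structure PrikryCondition (𝒞 : Set (Set ℕ)) where
  stem : Finset ℕ
  promise : Set 𝒞
  finite_promise : promise.Finite

variable {𝒞 : Set (Set ℕ)}

instance : Preorder (PrikryCondition 𝒞) where
  le p q := q.stem ⊆ p.stem ∧ q.promise ⊆ p.promise ∧
    ∀ n ∈ p.stem, n ∉ q.stem → ∀ c ∈ q.promise, n ∈ c.1
  le_refl p := ⟨Finset.Subset.refl _, Subset.rfl, fun _ h h' => absurd h h'⟩
  le_trans p q r hpq hqr := ⟨hqr.1.trans hpq.1, hqr.2.1.trans hpq.2.1, fun n hn hnr c hc => by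
    by_cases h : n ∈ q.stem
    · exact hqr.2.2 n h hnr c hc
    · exact hpq.2.2 n hn h c (hqr.2.1 hc)⟩

instance : Nonempty (PrikryCondition 𝒞) := ⟨⟨∅, ∅, finite_empty⟩⟩

/-- Conditions with equal stems are compatible through the union of their promises, and there are
only countably many stems. -/
theorem isCCC_prikryCondition : IsCCC (PrikryCondition 𝒞) := by
  intro A hA
  refine MapsTo.countable_of_injOn (f := PrikryCondition.stem) (mapsTo_univ _ _) ?_
    (countable_univ (α := Finset ℕ))
  intro p hp q hq hpq
  by_contra hne
  have hstem : p.stem = q.stem := hpq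
  rcases hA hp hq hne ⟨p.stem, p.promise ∪ q.promise, p.finite_promise.union q.finite_promise⟩ with
    h | h
  · exact h ⟨Finset.Subset.refl _, subset_union_left, fun n hn hn' => absurd hn hn'⟩
  · exact h ⟨hstem.symm.subset, subset_union_right, fun n hn hn' => absurd (hstem ▸ hn) hn'⟩

/-- Under `MA(κ)`, a family of at most `κ` sets all of whose finite intersections are infinite has
an infinite pseudo-intersection. -/
theorem MartinsAxiomAt.exists_pseudoIntersection {κ : Cardinal.{0}} (hMA : MartinsAxiomAt κ)
    (hκ : Cardinal.aleph0 ≤ κ) (hcard : Cardinal.mk 𝒞 ≤ κ)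
    (hinf : ∀ F ⊆ 𝒞, F.Finite → (⋂₀ F).Infinite) :
    ∃ y : Set ℕ, y.Infinite ∧ ∀ c ∈ 𝒞, (y \ c).Finite := by
  let D : 𝒞 ⊕ ℕ → Set (PrikryCondition 𝒞) :=
    Sum.elim (fun c => {p | c ∈ p.promise}) (fun n => {p | ∃ m ∈ p.stem, n < m})
  have hDcard : Cardinal.mk (range D) ≤ κ := by
    refine Cardinal.mk_range_le.trans ?_
    rw [Cardinal.mk_sum, Cardinal.lift_id, Cardinal.lift_id, Cardinal.mk_nat]
    exact Cardinal.add_le_of_le hκ hcard hκ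
  obtain ⟨G, hG⟩ := hMA (PrikryCondition 𝒞) isCCC_prikryCondition (range D) hDcard (by
    rintro _ ⟨c | n, rfl⟩ p
    · exact ⟨⟨p.stem, insert c p.promise, p.finite_promise.insert c⟩, mem_insert _ _,
        Finset.Subset.refl _, subset_insert _ _, fun n hn hn' => absurd hn hn'⟩
    · obtain ⟨m, hm, hnm⟩ := (hinf (Subtype.val '' p.promise) (by rintro _ ⟨c, -, rfl⟩; exact c.2)
        (p.finite_promise.image _)).exists_gt n
      refine ⟨⟨insert m p.stem, p.promise, p.finite_promise⟩, ⟨m, Finset.mem_insert_self _ _, hnm⟩,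
        Finset.subset_insert _ _, Subset.rfl, fun k hk hk' c hc => ?_⟩
      obtain rfl := (Finset.mem_insert.1 hk).resolve_right hk'
      exact hm c.1 ⟨c, hc, rfl⟩)
  refine ⟨{n | ∃ p ∈ G, n ∈ p.stem}, ?_, fun c hc => ?_⟩
  · refine infinite_of_not_bddAbove fun ⟨n, hn⟩ => ?_
    obtain ⟨p, ⟨m, hm, hnm⟩, hpG⟩ := hG _ ⟨Sum.inr n, rfl⟩
    exact hnm.not_ge (hn ⟨p, hpG, hm⟩)
  · obtain ⟨p, hp, hpG⟩ := hG _ ⟨Sum.inl ⟨c, hc⟩, rfl⟩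
    refine p.stem.finite_toSet.subset ?_
    rintro n ⟨⟨q, hqG, hn⟩, hnc⟩
    -- A common extension adds to `p.stem` only elements of `c`, so `n ∉ c` puts `n` in `p.stem`.
    obtain ⟨r, -, hrp, hrq⟩ := G.directed p hpG q hqG
    by_contra hnp
    exact hnc (hrp.2.2 n (hrq.1 hn) hnp _ hp)

end MartinsAxiom

/-! ### Initial segments and branches in Baire space. -/

section Baire

/-- The basic open subset of Baire space given by a finite initial segment, listed backwards as in
`PiNat.res`. -/
def initialSegmentSet (s : List ℕ) : Set (ℕ → ℕ) :=
  {x | PiNat.res x s.length = s}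

theorem mem_initialSegmentSet_res {x y : ℕ → ℕ} {n : ℕ} :
    y ∈ initialSegmentSet (PiNat.res x n) ↔ ∀ i < n, y i = x i := by
  simp [initialSegmentSet, PiNat.res_eq_res]

theorem res_mem_initialSegmentSet (x : ℕ → ℕ) (n : ℕ) :
    x ∈ initialSegmentSet (PiNat.res x n) :=
  mem_initialSegmentSet_res.2 fun _ _ => rfl

theorem initialSegmentSet_cons_subset (a : ℕ) (s : List ℕ) :
    initialSegmentSet (a :: s) ⊆ initialSegmentSet s := fun x hx => by
  simp only [initialSegmentSet, mem_ofPred_eq, List.length_cons, PiNat.res_succ,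
    List.cons.injEq] at hx ⊢
  exact hx.2

theorem exists_initialSegmentSet_subset {x : ℕ → ℕ} {U : Set (ℕ → ℕ)} (hU : U ∈ 𝓝 x) :
    ∃ n, ∀ m ≥ n, initialSegmentSet (PiNat.res x m) ⊆ U := by
  obtain ⟨_, ⟨z, n, rfl⟩, hx, hsub⟩ :=
    (PiNat.isTopologicalBasis_cylinders (E := fun _ : ℕ => ℕ)).mem_nhds_iff.1 hU
  refine ⟨n, fun m hm y hy => hsub fun i hi => ?_⟩
  rw [mem_initialSegmentSet_res.1 hy i (hi.trans_le hm)]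
  exact hx i hi

theorem exists_forall_res {P : List ℕ → Prop} (hnil : P [])
    (hcons : ∀ s, P s → ∃ a, P (a :: s)) : ∃ x : ℕ → ℕ, ∀ n, P (PiNat.res x n) := by
  choose! a ha using hcons
  let c : ℕ → List ℕ := fun n => Nat.rec [] (fun _ s => a s :: s) n
  have hc : ∀ n, PiNat.res (fun n => a (c n)) n = c n := fun n => by
    induction n with
    | zero => rfl
    | succ n ih => rw [PiNat.res_succ, ih]
  refine ⟨fun n => a (c n), fun n => ?_⟩
  rw [hc]
  induction n with
  | zero => exact hnil
  | succ n ih => exact ha _ ih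

/-- Approximations that agree on longer and longer initial segments converge. -/
theorem exists_forall_eq_of_approx (α : ℕ → ℕ → ℕ) (m : ℕ → ℕ) (hm : StrictMono m)
    (h : ∀ k, ∀ i < m k, α (k + 1) i = α k i) : ∃ x : ℕ → ℕ, ∀ k, ∀ i < m k, x i = α k i := by
  have hle : ∀ j k, j ≤ k → ∀ i < m j, α k i = α j i := fun j k hjk i hi => by
    induction k, hjk using Nat.le_induction with
    | base => rfl
    | succ k hjk ih => rw [h k i (hi.trans_le (hm.monotone hjk)), ih]
  -- Since `i < m (i + 1)`, coordinate `i` is settled by stage `i + 1`.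
  refine ⟨fun i => α (i + 1) i, fun k i hi => ?_⟩
  rcases le_total k (i + 1) with hk | hk
  · exact hle k (i + 1) hk i hi
  · exact (hle (i + 1) k hk i ((Nat.lt_succ_self i).trans_le (hm.id_le _))).symm

end Baire

/-! ### Coanalytic sets as unions of `ℵ₁` analytic sets. -/

section Coanalytic

open Ordinal

variable {X : Type*} [TopologicalSpace X]

/-- By continuity the images of the initial segments of `x` shrink to `g x`. -/
theorem eq_of_forall_mem_closure_image [T2Space X] [RegularSpace X] {g : (ℕ → ℕ) → X}
    (hg : Continuous g) {x : ℕ → ℕ} {z : X}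
    (h : ∀ n, z ∈ closure (g '' initialSegmentSet (PiNat.res x n))) : z = g x := by
  by_contra hne
  obtain ⟨V, ⟨hV, hVc⟩, hVz⟩ := (closed_nhds_basis (g x)).mem_iff.1
    (isOpen_compl_singleton.mem_nhds (Ne.symm hne) : {z}ᶜ ∈ 𝓝 (g x))
  obtain ⟨n, hn⟩ := exists_initialSegmentSet_subset (hg.continuousAt hV)
  exact hVz (closure_minimal (image_subset_iff.2 (hn n le_rfl)) hVc (h n)) rfl

theorem countable_Iio_of_lt_omega_one {o : Ordinal.{0}} (ho : o < ω_ 1) : (Iio o).Countable := by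
  rw [← Cardinal.le_aleph0_iff_set_countable, Cardinal.mk_Iio_ordinal, Cardinal.lift_le_aleph0]
  rw [← Cardinal.ord_aleph, Cardinal.lt_ord, ← zero_add (1 : Ordinal), ← Cardinal.succ_aleph,
    Cardinal.aleph_zero, Order.lt_succ_iff] at ho
  exact ho

theorem exists_Iio_subset_range {o : Ordinal.{0}} (ho : o < ω_ 1) :
    ∃ φ : ℕ → Ordinal.{0}, Iio o ⊆ range φ := by
  rcases (Iio o).eq_empty_or_nonempty with h | h
  · exact ⟨fun _ => 0, by simp [h]⟩
  · obtain ⟨φ, hφ⟩ := (countable_Iio_of_lt_omega_one ho).exists_eq_range h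
    exact ⟨φ, hφ.subset⟩

theorem rank_lt_omega_one {β : Type} [Countable β] (r : β → β → Prop) [IsWellFounded β r] (b : β) :
    IsWellFounded.rank r b < ω_ 1 := by
  induction b using IsWellFounded.induction r with
  | ind b ih =>
    rw [IsWellFounded.rank_eq]
    exact iSup_lt_omega_one fun c => (Cardinal.isSuccLimit_omega 1).succ_lt (ih c.1 c.2)

/-- A coanalytic set is a union of `ℵ₁` analytic sets. -/
theorem exists_eq_iUnion_of_analyticSet_compl [PolishSpace X] {B : Set X} (hB : AnalyticSet Bᶜ) :
    ∃ C : Ordinal.{0} → Set X, (∀ o, AnalyticSet (C o)) ∧ B = ⋃ o ∈ Iio (ω_ 1), C o := by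
  rw [AnalyticSet] at hB
  rcases hB with hB | ⟨g, hg, hgB⟩
  · refine ⟨fun _ => univ, fun _ => isClosed_univ.analyticSet, ?_⟩
    rw [compl_empty_iff.1 hB]
    exact (eq_univ_of_forall fun x => mem_iUnion₂.2 ⟨0, omega_pos 1, mem_univ x⟩).symm
  choose! φ hφ using fun (o : Ordinal.{0}) (ho : o < ω_ 1) => exists_Iio_subset_range ho
  let T : List ℕ → Set X := fun s => closure (g '' initialSegmentSet s)
  -- The function `p.2` codes a rank function on the tree of all `s` with `p.1 ∈ T s`. Coding
  -- ordinals by their indices under `φ o` leaves only countable operations, so `E o` is Borel.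
  let E : Ordinal.{0} → Set (X × (List ℕ → ℕ)) := fun o =>
    ⋂ (s : List ℕ) (a : ℕ), {p | p.1 ∈ T (a :: s) → φ o (p.2 (a :: s)) < φ o (p.2 s)}
  refine ⟨fun o => Prod.fst '' E o, fun o => ?_, ?_⟩
  · borelize (X × (List ℕ → ℕ))
    have hE : MeasurableSet (E o) := by
      refine MeasurableSet.iInter fun s => MeasurableSet.iInter fun a => ?_
      refine IsOpen.measurableSet ?_
      simp only [imp_iff_not_or, ofPred_or]
      refine IsOpen.union (isClosed_closure.preimage continuous_fst).isOpen_compl ?_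
      have hcont : Continuous fun p : X × (List ℕ → ℕ) => (p.2 (a :: s), p.2 s) := by fun_prop
      exact (isOpen_discrete {q : ℕ × ℕ | φ o q.1 < φ o q.2}).preimage hcont
    exact hE.analyticSet.image_of_continuous continuous_fst
  ext z
  simp only [mem_iUnion, exists_prop, mem_image, Prod.exists, exists_and_right, exists_eq_right]
  constructor
  · intro hz
    let r : List ℕ → List ℕ → Prop := fun t s => t.tail = s ∧ t ≠ [] ∧ z ∈ T t
    -- An inaccessible root would start an infinite branch `x` of the tree of `z`, forcing `z = g
    -- x`.
    have hnil : Acc r [] := by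
      by_contra hnil
      obtain ⟨x, hx⟩ := exists_forall_res (P := fun s => ¬ Acc r s) hnil fun s hs => by
        by_contra! hcon
        refine hs ⟨s, ?_⟩
        rintro (_ | ⟨a, t⟩) ⟨hts, hne, -⟩
        · exact absurd rfl hne
        · obtain rfl : t = s := hts
          exact hcon a
      have hxT : ∀ n, z ∈ T (PiNat.res x n) := fun n => by
        by_contra hn
        refine hx n ⟨_, ?_⟩
        rintro (_ | ⟨a, t⟩) ⟨hts, hne, ht⟩
        · exact absurd rfl hne
        · obtain rfl : t = PiNat.res x n := hts
          exact absurd (closure_mono (image_mono (initialSegmentSet_cons_subset a _)) ht) hn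
      have : z ∈ Bᶜ := hgB ▸ ⟨x, (eq_of_forall_mem_closure_image hg hxT).symm⟩
      exact this hz
    have hacc : ∀ s, Acc r s := fun s => by
      induction s with
      | nil => exact hnil
      | cons a s ih =>
        by_cases h : z ∈ T (a :: s)
        · exact ih.inv ⟨rfl, List.cons_ne_nil _ _, h⟩
        · refine ⟨_, ?_⟩
          rintro (_ | ⟨b, t⟩) ⟨hts, hne, ht⟩
          · exact absurd rfl hne
          · obtain rfl : t = a :: s := hts
            exact absurd (closure_mono (image_mono (initialSegmentSet_cons_subset b _)) ht) h
    have : IsWellFounded (List ℕ) r := ⟨⟨hacc⟩⟩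
    let o : Ordinal.{0} := ⨆ s, Order.succ (IsWellFounded.rank r s)
    have ho : o < ω_ 1 :=
      iSup_lt_omega_one fun s => (Cardinal.isSuccLimit_omega 1).succ_lt (rank_lt_omega_one r s)
    have hlt : ∀ s, IsWellFounded.rank r s < o := fun s =>
      (Order.lt_succ _).trans_le (Ordinal.le_iSup _ s)
    choose f hf using fun s => hφ o ho (hlt s)
    refine ⟨o, ho, f, mem_iInter₂.2 fun s a h => ?_⟩
    simp only [hf]
    exact IsWellFounded.rank_lt_of_rel ⟨rfl, List.cons_ne_nil _ _, h⟩
  · rintro ⟨o, -, f, hf⟩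
    by_contra hz
    -- The branch `x` lies in the tree of `g x` and would carry an infinite descending sequence of
    -- ordinals.
    obtain ⟨x, rfl⟩ : z ∈ range g := hgB ▸ hz
    have hdec : ∀ n, φ o (f (PiNat.res x (n + 1))) < φ o (f (PiNat.res x n)) := fun n =>
      mem_iInter₂.1 hf (PiNat.res x n) (x n)
        (subset_closure ⟨x, res_mem_initialSegmentSet x (n + 1), rfl⟩)
    exact (RelEmbedding.natGT (r := (· < ·)) (fun n => φ o (f (PiNat.res x n))) hdec).not_wellFounded wellFounded_lt

end Coanalytic

/-! ### Avoiding an analytic subfamily below a positive set. -/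

section Key

variable {𝒜 : Set (Set ℕ)}

/-- The subset of `ℕ` with a given characteristic function. -/
def boolSupport (f : ℕ → Bool) : Set ℕ :=
  {n | f n = true}

/-- Below every positive set of a mad family there is a positive set almost disjoint from all
members of a given analytic subfamily. -/
theorem IsMadFamily.exists_isPositive_finite_inter (h𝒜 : IsMadFamily 𝒜) {B : Set (ℕ → Bool)}
    (hB : AnalyticSet B) (hB𝒜 : ∀ f ∈ B, boolSupport f ∈ 𝒜) {x : Set ℕ} (hx : IsPositive 𝒜 x) :
    ∃ y, IsPositive 𝒜 y ∧ (y \ x).Finite ∧ ∀ f ∈ B, (y ∩ boolSupport f).Finite := by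
  rw [AnalyticSet] at hB
  rcases hB with rfl | ⟨g, hg, rfl⟩
  · exact ⟨x, hx, by simp, by simp⟩
  let b : (ℕ → ℕ) → Set ℕ := fun α => boolSupport (g α)
  let Kills : Set ℕ → List ℕ → Prop := fun y s => ∀ α ∈ initialSegmentSet s, (y ∩ b α).Finite
  have hKills : ∀ {y z : Set ℕ} {s}, Kills y s → (z \ y).Finite → Kills z s :=
    fun h hzy α hα => finite_inter_of_finite_diff hzy (h α hα)
  have hb𝒜 : ∀ α, b α ∈ 𝒜 := fun α => hB𝒜 _ (mem_range_self α)
  have hloc : ∀ α n, ∃ m, ∀ k ≥ m, ∀ β ∈ initialSegmentSet (PiNat.res α k), g β n = g α n :=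
    fun α n => exists_initialSegmentSet_subset
      (((continuous_apply n).comp hg).continuousAt.preimage_mem_nhds
        ((isOpen_discrete {g α n}).mem_nhds rfl))
  obtain ⟨e, he⟩ := exists_surjective_nat (List ℕ)
  -- Shrink until every node is decided: either `y` kills it, or no positive set almost contained in
  -- `y` does.
  obtain ⟨y, hy, hyx, hyD⟩ := h𝒜.exists_isPositive_forall
    (D := fun n y => Kills y (e n) ∨ ∀ z, IsPositive 𝒜 z → (z \ y).Finite → ¬ Kills z (e n))
    (fun n u hu => by
      by_cases h : ∃ z, IsPositive 𝒜 z ∧ (z \ u).Finite ∧ Kills z (e n)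
      · obtain ⟨z, hz, hzu, hk⟩ := h
        exact ⟨z ∩ u, inter_subset_right, hz.of_finite_diff (by simpa using hzu),
          Or.inl (hKills hk (by simp [sdiff_eq_empty.2 inter_subset_left]))⟩
      · push Not at h
        exact ⟨u, Subset.rfl, hu, Or.inr h⟩)
    (fun n u z h hzu => h.imp (fun h => hKills h hzu)
      fun h w hw hwz => h w hw (finite_diff_trans hwz hzu)) hx
  let S : List ℕ → Prop := fun s => ∀ z, IsPositive 𝒜 z → (z \ y).Finite → ¬ Kills z s
  have hS : ∀ s, Kills y s ∨ S s := fun s => by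
    obtain ⟨n, rfl⟩ := he s
    exact hyD n
  have hSres : ∀ {α}, (y ∩ b α).Infinite → ∀ k, S (PiNat.res α k) := fun {α} hα k =>
    (hS _).resolve_left fun h => hα (h α (res_mem_initialSegmentSet α k))
  by_cases hnil : Kills y []
  · refine ⟨y, hy, hyx, ?_⟩
    rintro _ ⟨α, rfl⟩
    exact hnil α rfl
  exfalso
  have hSnil : S [] := (hS []).resolve_left hnil
  -- the members of the trees below `s` and `t` share arbitrarily large elements
  let U : List ℕ → Set ℕ := fun s => {n | ∃ α ∈ initialSegmentSet s, ∃ m, ∀ k ≥ m,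
    S (PiNat.res α k) ∧ ∀ β ∈ initialSegmentSet (PiNat.res α k), n ∈ b β}
  -- Otherwise `y \ U s` would be a positive set killing `s`: if `α` passes through `s` and `y ∩ b
  -- α` is infinite, all initial segments of `α` satisfy `S`, so continuity gives `b α ⊆ U s`.
  have hU : ∀ s, S s → ¬ IsPositive 𝒜 (y \ U s) := fun s hs hpos => by
    refine hs _ hpos (by simp [sdiff_sdiff_comm]) fun α hα => ?_
    by_contra hinf
    have hyα : (y ∩ b α).Infinite := fun h =>
      hinf (h.subset (inter_subset_inter_left _ sdiff_subset))
    obtain ⟨n, ⟨-, hnU⟩, hnb⟩ := Set.Infinite.nonempty hinf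
    obtain ⟨m, hm⟩ := hloc α n
    exact hnU ⟨α, hα, m, fun k hk => ⟨hSres hyα k, fun β hβ => (hm k hk β hβ).trans hnb⟩⟩
  have hUU : ∀ s t, S s → S t → (U s ∩ U t).Infinite := fun s t hs ht => by
    have h1 : IsPositive 𝒜 (y ∩ U s) := hy.inter_of_diff (hU s hs)
    have h2 : IsPositive 𝒜 (y ∩ U s ∩ U t) := h1.inter_of_diff fun h =>
      hU t ht (h.of_finite_diff (by
        rw [sdiff_eq_empty.2 (sdiff_subset_sdiff_left inter_subset_left)]
        exact finite_empty))
    exact h2.infinite.mono (inter_subset_inter_left _ inter_subset_right)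
  -- two distinct starting points
  obtain ⟨α₀, hα₀⟩ : ∃ α, (y ∩ b α).Infinite := by
    by_contra! h
    exact hnil fun α _ => h α
  -- Otherwise `y \ b α₀`, still positive, would kill the root.
  obtain ⟨α₁, hα₁⟩ : ∃ α, ((y \ b α₀) ∩ b α).Infinite := by
    by_contra! h
    have hpos : IsPositive 𝒜 (y \ b α₀) := by
      simpa using hy.diff_sUnion (singleton_subset_iff.2 (hb𝒜 α₀)) (finite_singleton _)
    exact hSnil _ hpos (by simp [sdiff_sdiff_comm]) fun α _ => h α
  -- `n₀` lies in `b α₁` but not in `b α₀`. Starting the fusion at length `m₀ + m₁` freezes this, so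
  -- the two limit branches give distinct members.
  obtain ⟨n₀, ⟨-, hn₀⟩, hn₁⟩ := hα₁.nonempty
  obtain ⟨m₀, hm₀⟩ := hloc α₀ n₀
  obtain ⟨m₁, hm₁⟩ := hloc α₁ n₀
  -- a fusion of two branches with infinite intersection
  let Good : (ℕ → ℕ) × (ℕ → ℕ) × ℕ → Prop := fun p =>
    S (PiNat.res p.1 p.2.2) ∧ S (PiNat.res p.2.1 p.2.2)
  have hstep : ∀ (k : ℕ) p, Good p → ∃ q, Good q ∧ p.2.2 < q.2.2 ∧
      (∀ i < p.2.2, q.1 i = p.1 i ∧ q.2.1 i = p.2.1 i) ∧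
      ∃ n > k, ∀ β, (∀ i < q.2.2, β i = q.1 i) → ∀ γ, (∀ i < q.2.2, γ i = q.2.1 i) →
        n ∈ b β ∩ b γ := by
    rintro k ⟨α, β, m⟩ ⟨hα, hβ⟩
    obtain ⟨n, ⟨⟨α', hα', mα, hmα⟩, ⟨β', hβ', mβ, hmβ⟩⟩, hkn⟩ := (hUU _ _ hα hβ).exists_gt k
    have h1 := hmα (mα + mβ + m + 1) (by omega)
    have h2 := hmβ (mα + mβ + m + 1) (by omega)
    exact ⟨⟨α', β', mα + mβ + m + 1⟩, ⟨h1.1, h2.1⟩, show m < mα + mβ + m + 1 by omega,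
      fun i hi => ⟨mem_initialSegmentSet_res.1 hα' i hi, mem_initialSegmentSet_res.1 hβ' i hi⟩,
      n, hkn, fun β hβ γ hγ => ⟨h1.2 β (mem_initialSegmentSet_res.2 hβ),
        h2.2 γ (mem_initialSegmentSet_res.2 hγ)⟩⟩
  choose! next hnext hlt hagree n hkn hn using hstep
  let p : ℕ → (ℕ → ℕ) × (ℕ → ℕ) × ℕ := fun k => Nat.rec (α₀, α₁, m₀ + m₁) next k
  have hp : ∀ k, Good (p k) := fun k => by
    induction k with
    | zero =>
      exact ⟨hSres hα₀ _, hSres (hα₁.mono (inter_subset_inter_left _ sdiff_subset)) _⟩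
    | succ k ih => exact hnext k _ ih
  have hmono : StrictMono fun k => (p k).2.2 := strictMono_nat_of_lt_succ fun k => hlt k _ (hp k)
  obtain ⟨α, hα⟩ := exists_forall_eq_of_approx (fun k => (p k).1) (fun k => (p k).2.2) hmono
    fun k i hi => (hagree k _ (hp k) i hi).1
  obtain ⟨β, hβ⟩ := exists_forall_eq_of_approx (fun k => (p k).2.1) (fun k => (p k).2.2) hmono
    fun k i hi => (hagree k _ (hp k) i hi).2
  have hinf : (b α ∩ b β).Infinite := infinite_of_not_bddAbove fun ⟨k, hk⟩ =>
    (hkn k _ (hp k)).not_ge (hk (hn k _ (hp k) α (hα (k + 1)) β (hβ (k + 1))))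
  rcases h𝒜.prop.eq_or_finite_inter _ (hb𝒜 α) _ (hb𝒜 β) with heq | hfin
  · have h0 : g α n₀ = g α₀ n₀ := hm₀ (m₀ + m₁) (by omega) α (mem_initialSegmentSet_res.2 (hα 0))
    have h1 : g β n₀ = g α₁ n₀ := hm₁ (m₀ + m₁) (by omega) β (mem_initialSegmentSet_res.2 (hβ 0))
    have h2 : n₀ ∈ b β := h1.trans hn₁
    rw [← heq] at h2
    exact hn₀ (h0.symm.trans h2)
  · exact hinf hfin

end Key

/-! ### Towers of positive sets of length `ω₁`. -/

section Tower

open Ordinal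

variable {𝒜 : Set (Set ℕ)}

/-- The member of largest index is almost contained in the others. The empty intersection is `univ`,
positive because `𝒜` is infinite. -/
theorem IsMadFamily.isPositive_sInter_of_tower (h𝒜 : IsMadFamily 𝒜) (hinf : 𝒜.Infinite)
    {x : Ordinal.{0} → Set ℕ} {J : Set Ordinal.{0}}
    (hx : ∀ o ∈ J, IsPositive 𝒜 (x o) ∧ ∀ o' < o, (x o \ x o').Finite) {F : Set (Set ℕ)}
    (hF : F ⊆ x '' J) (hfin : F.Finite) : IsPositive 𝒜 (⋂₀ F) := by
  obtain ⟨I, hI, hIfin, rfl⟩ := exists_subset_image_finite_and.1 ⟨F, hF, hfin, rfl⟩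
  rcases I.eq_empty_or_nonempty with rfl | hne
  · simpa using h𝒜.isPositive_univ hinf
  obtain ⟨m, hm, hmax⟩ := exists_max_image I id hIfin hne
  refine (hx m (hI hm)).1.of_finite_diff ?_
  rw [sInter_image, sdiff_iInter]
  simp only [sdiff_iInter]
  refine hIfin.biUnion fun i hi => ?_
  rcases (hmax i hi).lt_or_eq with h | h
  · exact (hx m (hI hm)).2 i h
  · simp only [id_eq] at h
    simp [h]

/-- Requirements indexed by the countable ordinals can be met along a tower of positive sets. -/
theorem IsMadFamily.exists_tower (h𝒜 : IsMadFamily 𝒜) (hinf : 𝒜.Infinite)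
    {K : Ordinal.{0} → Set ℕ → Prop}
    (hK : ∀ o x, IsPositive 𝒜 x → ∃ y, IsPositive 𝒜 y ∧ (y \ x).Finite ∧ K o y) :
    ∃ x : Ordinal.{0} → Set ℕ, ∀ o < ω_ 1,
      IsPositive 𝒜 (x o) ∧ (∀ o' < o, (x o \ x o').Finite) ∧ K o (x o) := by
  classical
  let Q : (o : Ordinal.{0}) → ((o' : Ordinal.{0}) → o' < o → Set ℕ) → Set ℕ → Prop :=
    fun o ih y => IsPositive 𝒜 y ∧ (∀ o' h, (y \ ih o' h).Finite) ∧ K o y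
  -- The default `∅` is never taken below `ω₁`.
  let x : Ordinal.{0} → Set ℕ := wellFounded_lt.fix fun o ih =>
    if h : ∃ y, Q o ih y then h.choose else ∅
  refine ⟨x, fun o => ?_⟩
  induction o using WellFoundedLT.induction with
  | ind o ih =>
    intro ho
    have hQ : ∃ y, Q o (fun o' _ => x o') y := by
      have hpos : ∀ F ⊆ x '' Iio o, F.Finite → IsPositive 𝒜 (⋂₀ F) := fun F =>
        h𝒜.isPositive_sInter_of_tower hinf fun i hi =>
          have h := ih i hi (lt_trans hi ho)
          ⟨h.1, h.2.1⟩
      obtain ⟨u, hu, hux⟩ := h𝒜.exists_isPositive_of_countable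
        ((countable_Iio_of_lt_omega_one ho).image x) hpos
      obtain ⟨y, hy, hyu, hKy⟩ := hK o u hu
      exact ⟨y, hy, fun o' h => finite_diff_trans hyu (hux _ ⟨o', h, rfl⟩), hKy⟩
    have hx : x o = hQ.choose := by
      rw [show x o = _ from wellFounded_lt.fix_eq _ o]
      exact dif_pos hQ
    have := hQ.choose_spec
    rw [← hx] at this
    exact this

theorem mk_image_Iio_omega_one_le (x : Ordinal.{0} → Set ℕ) :
    Cardinal.mk (x '' Iio (ω_ 1)) ≤ Cardinal.aleph 1 := by
  have h := Cardinal.mk_image_le_lift (f := x) (s := Iio (ω_ 1))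
  rw [Cardinal.mk_Iio_ordinal, Cardinal.lift_lift] at h
  simpa using h

end Tower

/-! ### The contradiction with maximality. -/

open Ordinal in
theorem mainTheorem5 (hMA : MartinsAxiomAt (Cardinal.aleph 1)) :
    ¬ ∃ 𝒜 : Set (Set ℕ), 𝒜.Infinite ∧ IsMadFamily 𝒜 ∧ IsBoldSigmaOneTwo (toCantor 𝒜) := by
  rintro ⟨𝒜, hinf, h𝒜, B, hB, hBA⟩
  have : PolishSpace ((ℕ → Bool) × (ℕ → ℕ)) := {}
  obtain ⟨C, hC, hBC⟩ := exists_eq_iUnion_of_analyticSet_compl hB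
  have hmem : ∀ f, boolSupport f ∈ 𝒜 ↔ ∃ o < ω_ 1, f ∈ Prod.fst '' C o := fun f => by
    change f ∈ toCantor 𝒜 ↔ _
    rw [hBA, hBC, image_iUnion₂]
    simp
  obtain ⟨x, hx⟩ := h𝒜.exists_tower hinf
    -- The requirement is vacuous from `ω₁` on, since `K` must be attainable at every ordinal.
    (K := fun o y => o < ω_ 1 → ∀ f ∈ Prod.fst '' C o, (y ∩ boolSupport f).Finite)
    (fun o u hu => by
      by_cases ho : o < ω_ 1
      · obtain ⟨y, hy, hyu, h⟩ := h𝒜.exists_isPositive_finite_inter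
          ((hC o).image_of_continuous continuous_fst) (fun f hf => (hmem f).2 ⟨o, ho, hf⟩) hu
        exact ⟨y, hy, hyu, fun _ => h⟩
      · exact ⟨u, hu, by simp, fun h => absurd h ho⟩)
  obtain ⟨y, hyinf, hy⟩ := hMA.exists_pseudoIntersection (Cardinal.aleph0_le_aleph 1)
    (mk_image_Iio_omega_one_le x) fun F hF hfin =>
      (h𝒜.isPositive_sInter_of_tower hinf
        (fun o ho => ⟨(hx o ho).1, (hx o ho).2.1⟩) hF hfin).infinite
  -- This `a` belongs to the subfamily of some `o < ω₁`, yet `y` is almost contained in `x o`, which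
  -- meets `a` in a finite set.
  obtain ⟨a, ha, hay⟩ := h𝒜.exists_infinite_inter hyinf
  classical
  obtain ⟨f, rfl⟩ : ∃ f, boolSupport f = a := ⟨fun n => decide (n ∈ a), by simp [boolSupport]⟩
  obtain ⟨o, ho, hf⟩ := (hmem f).1 ha
  rw [inter_comm] at hay
  exact hay (finite_inter_of_finite_diff (hy _ ⟨o, ho, rfl⟩) ((hx o ho).2.2 ho f hf))
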